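/- Let $A$ be a (complex, not necessarily unital) C*-algebra that is not commutative. Then there exist elements $a, b \in A$ such that $ab = 0$ but $b^n a^n \neq 0$ for every integer $n \geq 1$. -/

import Mathlib

/-- The `n`-th power `a ^ n = a * ⋯ * a` (`n` factors, `n ≥ 1`) in a possibly non-unital
multiplicative structure, where the exponent `0` makes no sense. -/
def posPow {A : Type*} [Mul A] (a : A) (n : ℕ+) : A :=
  PNat.recOn n a (fun _ x => x * a)

theorem posPow_one {A : Type*} [Mul A] (a : A) : posPow a 1 = a := by
  simp [posPow]

theorem posPow_succ {A : Type*} [Mul A] (a : A) (n : ℕ+) :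
    posPow a (n + 1) = posPow a n * a := by
  simp [posPow]

theorem posPow_eq_pow {A : Type*} [Monoid A] (a : A) (n : ℕ+) :
    posPow a n = a ^ (n : ℕ) := by
  induction n with
  | one => simp [posPow_one]
  | succ k ih => rw [posPow_succ, ih, PNat.add_coe, PNat.one_coe, pow_succ]

open MeasureTheory

/-! Noncommutativity yields `x ≠ 0` with `x * x = 0`; then `a = star x * x` and `b = x * star x + x`
work, because `star x * b ^ n * a ^ n = a ^ (2 * n)` and a nonzero selfadjoint element is not
nilpotent.

The existence of `x` is `mul_comm_of_reduced`. In a reduced algebra `q * p = 0` forces `p * y * q =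
0`, its square being zero. With `p`, `q` the positive and negative parts of `a - t`, `a`
selfadjoint, this gives `(a - t) y |a - t| = |a - t| y (a - t)`. Integrating over `t` turns `|a -
t|` into polynomials in `a`, and the identity becomes `[a, [a, [a, y]]] = 0`. The Leibniz rule and
reducedness lower the order to `[a, y] = 0`. -/

theorem integral_abs_sub {r M : ℝ} (h₁ : -M ≤ r) (h₂ : r ≤ M) :
    ∫ t in Set.Icc (-M) M, |r - t| = M ^ 2 + r ^ 2 := by
  rw [integral_Icc_eq_integral_Ioc, ← intervalIntegral.integral_of_le (h₁.trans h₂),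
    ← intervalIntegral.integral_add_adjacent_intervals (b := r)
      ((by fun_prop : Continuous fun t : ℝ => |r - t|).intervalIntegrable _ _)
      ((by fun_prop : Continuous fun t : ℝ => |r - t|).intervalIntegrable _ _)]
  have e₁ : ∫ t in (-M)..r, |r - t| = ∫ t in (-M)..r, (r - t) := by
    refine intervalIntegral.integral_congr fun t ht => ?_
    rw [Set.uIcc_of_le h₁] at ht
    exact abs_of_nonneg (sub_nonneg.2 ht.2)
  have e₂ : ∫ t in r..M, |r - t| = ∫ t in r..M, (t - r) := by
    refine intervalIntegral.integral_congr fun t ht => ?_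
    rw [Set.uIcc_of_le h₂] at ht
    simpa using abs_of_nonpos (sub_nonpos.2 ht.1)
  have c₁ (a b : ℝ) : IntervalIntegrable (fun t : ℝ => t) volume a b :=
    continuous_id.intervalIntegrable _ _
  have c₂ (a b : ℝ) : IntervalIntegrable (fun _ : ℝ => r) volume a b :=
    continuous_const.intervalIntegrable _ _
  rw [e₁, e₂, intervalIntegral.integral_sub (c₂ _ _) (c₁ _ _),
    intervalIntegral.integral_sub (c₁ _ _) (c₂ _ _), intervalIntegral.integral_const,
    intervalIntegral.integral_const, integral_id, integral_id]
  simp only [smul_eq_mul]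
  ring

theorem integral_mul_abs_sub {r M : ℝ} (h₁ : -M ≤ r) (h₂ : r ≤ M) :
    ∫ t in Set.Icc (-M) M, t * |r - t| = r ^ 3 / 3 - M ^ 2 * r := by
  rw [integral_Icc_eq_integral_Ioc, ← intervalIntegral.integral_of_le (h₁.trans h₂),
    ← intervalIntegral.integral_add_adjacent_intervals (b := r)
      ((by fun_prop : Continuous fun t : ℝ => t * |r - t|).intervalIntegrable _ _)
      ((by fun_prop : Continuous fun t : ℝ => t * |r - t|).intervalIntegrable _ _)]
  have e₁ : ∫ t in (-M)..r, t * |r - t| = ∫ t in (-M)..r, (r * t - t ^ 2) := by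
    refine intervalIntegral.integral_congr fun t ht => ?_
    rw [Set.uIcc_of_le h₁] at ht
    simp only [abs_of_nonneg (sub_nonneg.2 ht.2)]
    ring
  have e₂ : ∫ t in r..M, t * |r - t| = ∫ t in r..M, (t ^ 2 - r * t) := by
    refine intervalIntegral.integral_congr fun t ht => ?_
    rw [Set.uIcc_of_le h₂] at ht
    simp only [abs_of_nonpos (sub_nonpos.2 ht.1)]
    ring
  have c₁ (a b : ℝ) : IntervalIntegrable (fun t : ℝ => t ^ 2) volume a b :=
    (by fun_prop : Continuous fun t : ℝ => t ^ 2).intervalIntegrable _ _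
  have c₂ (a b : ℝ) : IntervalIntegrable (fun t : ℝ => r * t) volume a b :=
    (by fun_prop : Continuous fun t : ℝ => r * t).intervalIntegrable _ _
  rw [e₁, e₂, intervalIntegral.integral_sub (c₂ _ _) (c₁ _ _),
    intervalIntegral.integral_sub (c₁ _ _) (c₂ _ _), intervalIntegral.integral_const_mul,
    intervalIntegral.integral_const_mul, integral_pow, integral_pow, integral_id, integral_id]
  norm_num
  ring

/-! ### Functional calculus: the triple commutator identity. -/

section UnitalCStarAlgebra

variable {B : Type*} [CStarAlgebra B] {a : B}

theorem cfc_posPart_sub_negPart (ha : IsSelfAdjoint a) (t : ℝ) :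
    cfc (fun r : ℝ => max (r - t) 0) a - cfc (fun r : ℝ => max (t - r) 0) a
      = a - algebraMap ℝ B t := by
  have e : cfc (fun r : ℝ => r - t) a = a - algebraMap ℝ B t := by
    rw [cfc_sub _ _ a, cfc_id' ℝ a, cfc_const t a]
  rw [← cfc_sub _ _ a, ← e]
  refine cfc_congr fun r _ => ?_
  rcases le_total r t with h | h
  · simp [h]
  · simp [h]

theorem cfc_posPart_add_negPart (a : B) (t : ℝ) :
    cfc (fun r : ℝ => max (r - t) 0) a + cfc (fun r : ℝ => max (t - r) 0) a
      = cfc (fun r : ℝ => |r - t|) a := by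
  rw [← cfc_add _ _ _]
  refine cfc_congr fun r _ => ?_
  rcases le_total r t with h | h
  · simp [h, abs_of_nonpos (sub_nonpos.2 h)]
  · simp [h, abs_of_nonneg (sub_nonneg.2 h)]

theorem cfc_posPart_mul_negPart (a : B) (t : ℝ) :
    cfc (fun r : ℝ => max (r - t) 0) a * cfc (fun r : ℝ => max (t - r) 0) a = 0 := by
  rw [← cfc_mul _ _ _, ← cfc_zero ℝ a]
  refine cfc_congr fun r _ => ?_
  rcases le_total r t with h | h
  · simp [h]
  · simp [h]

theorem cfc_negPart_mul_posPart (a : B) (t : ℝ) :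
    cfc (fun r : ℝ => max (t - r) 0) a * cfc (fun r : ℝ => max (r - t) 0) a = 0 := by
  rw [cfc_commute_cfc _ _ a |>.eq, cfc_posPart_mul_negPart a t]

/-- If the positive and negative parts of every real translate of `a` annihilate `y` from the two
sides, then the threefold commutator of `y` with `a` vanishes. -/
theorem commutator_cube_eq_zero (ha : IsSelfAdjoint a) {y : B}
    (h₁ : ∀ t : ℝ, cfc (fun r : ℝ => max (r - t) 0) a * y * cfc (fun r : ℝ => max (t - r) 0) a = 0)
    (h₂ : ∀ t : ℝ, cfc (fun r : ℝ => max (t - r) 0) a * y * cfc (fun r : ℝ => max (r - t) 0) a = 0) :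
    a * a * a * y - 3 • (a * a * y * a) + 3 • (a * y * a * a) - y * a * a * a = 0 := by
  -- Both sides equal `p * y * p - q * y * q`, with `p`, `q` the positive and negative parts of `a -
  -- t`.
  have key (t : ℝ) : (a - algebraMap ℝ B t) * y * cfc (fun r : ℝ => |r - t|) a
      = cfc (fun r : ℝ => |r - t|) a * y * (a - algebraMap ℝ B t) := by
    rw [← cfc_posPart_sub_negPart ha, ← cfc_posPart_add_negPart a]
    simp only [add_mul, sub_mul, mul_add, mul_sub, h₁, h₂]
    abel
  obtain ⟨M, hM⟩ : ∃ M : ℝ, ∀ r ∈ spectrum ℝ a, |r| ≤ M :=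
    ⟨‖a‖ * ‖(1 : B)‖, fun r hr => spectrum.norm_le_norm_mul_of_mem hr⟩
  have hlo : ∀ r ∈ spectrum ℝ a, -M ≤ r := fun r hr => (abs_le.1 (hM r hr)).1
  have hhi : ∀ r ∈ spectrum ℝ a, r ≤ M := fun r hr => (abs_le.1 (hM r hr)).2
  have bd₀ : ∀ t ∈ Set.Icc (-M) M, ∀ r ∈ spectrum ℝ a, |r - t| ≤ M + M := fun t ht r hr =>
    (abs_sub r t).trans (add_le_add (hM r hr) (abs_le.2 ht))
  have bd₁ : ∀ t ∈ Set.Icc (-M) M, ∀ r ∈ spectrum ℝ a, ‖t * |r - t|‖ ≤ M * (M + M) := by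
    intro t ht r hr
    rw [norm_mul, Real.norm_eq_abs, Real.norm_eq_abs, abs_abs]
    exact mul_le_mul (abs_le.2 ht) (bd₀ t ht r hr) (abs_nonneg _) ((abs_nonneg t).trans (abs_le.2 ht))
  have cont₀ : Continuous (Function.uncurry fun t r : ℝ => |r - t|) := by
    unfold Function.uncurry; fun_prop
  have cont₁ : Continuous (Function.uncurry fun t r : ℝ => t * |r - t|) := by
    unfold Function.uncurry; fun_prop
  have fin (c : ℝ) : HasFiniteIntegral (fun _ : ℝ => c) (volume.restrict (Set.Icc (-M) M)) :=
    (integrable_const c).2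
  have ae₀ : ∀ᵐ t ∂(volume.restrict (Set.Icc (-M) M)), ∀ r ∈ spectrum ℝ a, ‖|r - t|‖ ≤ M + M := by
    refine ae_restrict_of_forall_mem measurableSet_Icc fun t ht r hr => ?_
    simpa using bd₀ t ht r hr
  have ae₁ : ∀ᵐ t ∂(volume.restrict (Set.Icc (-M) M)), ∀ r ∈ spectrum ℝ a,
      ‖t * |r - t|‖ ≤ M * (M + M) :=
    ae_restrict_of_forall_mem measurableSet_Icc bd₁
  have int₀ : IntegrableOn (fun t => cfc (fun r : ℝ => |r - t|) a) (Set.Icc (-M) M) :=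
    integrableOn_cfc measurableSet_Icc (fun t r : ℝ => |r - t|) (fun _ => M + M) a
      cont₀.continuousOn ae₀ (fin _) ha
  have int₁ : IntegrableOn (fun t => cfc (fun r : ℝ => t * |r - t|) a) (Set.Icc (-M) M) :=
    integrableOn_cfc measurableSet_Icc (fun t r : ℝ => t * |r - t|) (fun _ => M * (M + M)) a
      cont₁.continuousOn ae₁ (fin _) ha
  have J₀ : ∫ t in Set.Icc (-M) M, cfc (fun r : ℝ => |r - t|) a
      = algebraMap ℝ B (M ^ 2) + a * a := by
    rw [← cfc_setIntegral measurableSet_Icc (fun t r : ℝ => |r - t|) (fun _ => M + M) a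
      cont₀.continuousOn ae₀ (fin _) ha,
      cfc_congr (g := fun r : ℝ => M ^ 2 + r ^ 2)
        fun r hr => integral_abs_sub (hlo r hr) (hhi r hr),
      cfc_add a _ _, cfc_const _ a, cfc_pow_id a 2, pow_two a]
  have J₁ : ∫ t in Set.Icc (-M) M, cfc (fun r : ℝ => t * |r - t|) a
      = (3⁻¹ : ℝ) • (a * a * a) - (M ^ 2) • a := by
    rw [← cfc_setIntegral measurableSet_Icc (fun t r : ℝ => t * |r - t|) (fun _ => M * (M + M)) a
      cont₁.continuousOn ae₁ (fin _) ha,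
      cfc_congr (g := fun r : ℝ => 3⁻¹ * r ^ 3 - M ^ 2 * r)
        fun r hr => (integral_mul_abs_sub (hlo r hr) (hhi r hr)).trans (by ring),
      cfc_sub _ _ a, cfc_const_mul _ _ a, cfc_const_mul _ _ a, cfc_pow_id a 3, cfc_id' ℝ a,
      pow_succ, pow_two]
  have pt (t : ℝ) :
      a * y * cfc (fun r : ℝ => |r - t|) a - y * cfc (fun r : ℝ => t * |r - t|) a
        = cfc (fun r : ℝ => |r - t|) a * (y * a) - cfc (fun r : ℝ => t * |r - t|) a * y := by
    have := key t
    rw [cfc_const_mul t _ a]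
    simp only [sub_mul, mul_sub, Algebra.algebraMap_eq_smul_one, smul_mul_assoc, mul_smul_comm,
      one_mul, mul_one] at this ⊢
    rw [this, mul_assoc]
  -- After integration the `M ^ 2` terms are `M ^ 2 • (a * y + y * a)` on both sides and cancel;
  -- three times the rest is the claim.
  have main := congrArg (fun f : ℝ → B => ∫ t in Set.Icc (-M) M, f t) (funext pt)
  rw [integral_sub (int₀.const_mul _) (int₁.const_mul _),
    integral_sub (int₀.mul_const _) (int₁.mul_const _), integral_const_mul_of_integrable int₀,
    integral_const_mul_of_integrable int₁, integral_mul_const_of_integrable int₀,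
    integral_mul_const_of_integrable int₁, J₀, J₁] at main
  simp only [Algebra.algebraMap_eq_smul_one, mul_add, add_mul, mul_sub, sub_mul, smul_mul_assoc,
    mul_smul_comm, one_mul, mul_one] at main
  have main' := congrArg (fun z : B => (3 : ℝ) • z) (sub_eq_zero.2 main)
  simp only [smul_zero] at main'
  rw [← main']
  simp only [← mul_assoc]
  module

end UnitalCStarAlgebra

/-! ### Derivations on reduced rings. -/

section Reduced

variable {R : Type*} [NonUnitalRing R]

theorem commute_of_commutator_cube_eq_zero [IsAddTorsionFree R] (hR : ∀ x : R, x * x = 0 → x = 0) {a : R}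
    (h : ∀ y : R, a * a * a * y - 3 • (a * a * y * a) + 3 • (a * y * a * a) - y * a * a * a = 0)
    (y : R) : a * y = y * a := by
  set δ : R → R := fun x => a * x - x * a with hδ
  have leib (x z : R) : δ (x * z) = δ x * z + x * δ z := by simp only [hδ]; noncomm_ring
  have hadd (x z : R) : δ (x + z) = δ x + δ z := by simp only [hδ]; noncomm_ring
  have h3 (x : R) : δ (δ (δ x)) = 0 := by
    rw [← h x]; simp only [hδ]; noncomm_ring
  have h2 (x : R) : δ (δ x) = 0 := by
    apply hR
    -- By Leibniz and `δ³ = 0`, only `3 (δ² x)²` survives in `δ³ (δ x * x)`.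
    have e := h3 (δ x * x)
    simp only [leib, hadd, h3, zero_mul, mul_zero, zero_add, add_zero] at e
    have : 3 • (δ (δ x) * δ (δ x)) = 0 := by rw [← e]; abel
    exact (smul_eq_zero_iff_right (by norm_num)).1 this
  have h1 : δ y = 0 := by
    apply hR
    -- Likewise `δ² (y * y) = 2 (δ y)²` once `δ² = 0`.
    have e := h2 (y * y)
    simp only [leib, hadd, h2, zero_mul, mul_zero, zero_add, add_zero] at e
    have : 2 • (δ y * δ y) = 0 := by rw [← e]; abel
    exact (smul_eq_zero_iff_right (by norm_num)).1 this
  exact sub_eq_zero.1 h1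

end Reduced

/-- The C⋆-identity gives `‖s ^ 2 ^ n‖ = ‖s‖ ^ 2 ^ n`, and `n < 2 ^ n`. -/
theorem IsSelfAdjoint.pow_ne_zero {E : Type*} [NormedRing E] [StarRing E] [CStarRing E] {s : E}
    (hs : IsSelfAdjoint s) (h0 : s ≠ 0) (n : ℕ) : s ^ n ≠ 0 := by
  intro h
  have h2 : s ^ 2 ^ n = 0 := pow_eq_zero_of_le Nat.lt_two_pow_self.le h
  have := hs.norm_pow_two_pow n
  rw [h2, norm_zero] at this
  exact h0 (norm_eq_zero.1 (pow_eq_zero_iff (by positivity) |>.1 this.symm))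

/-- For a square-zero `x`, compressing the powers of `x * star x + x` yields powers of
`star x * x`. -/
theorem star_mul_pow_mul_star_mul_self {E : Type*} [Ring E] [StarRing E] {x : E} (hx : x * x = 0)
    (n : ℕ) :
    star x * (x * star x + x) ^ (n + 1) * (star x * x) = (star x * x) ^ (n + 2) := by
  have hx' : star x * star x = 0 := by rw [← star_mul, hx, star_zero]
  have h1 : star x * (x * star x + x) = star x * x * star x + star x * x := by noncomm_ring
  have h2 : star x * x * (x * star x + x) = 0 := by
    rw [show star x * x * (x * star x + x) = star x * (x * x) * star x + star x * (x * x) by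
      noncomm_ring, hx]
    simp
  induction n with
  | zero =>
    rw [zero_add, pow_one, h1, add_mul,
      show star x * x * star x * (star x * x) = star x * x * (star x * star x) * x by noncomm_ring,
      hx', zero_add, pow_two]
    simp
  | succ n ih =>
    have h3 : star x * (x * star x + x) ^ (n + 1 + 1)
        = star x * x * (star x * (x * star x + x) ^ (n + 1)) := by
      rw [pow_succ' _ (n + 1), ← mul_assoc, h1, add_mul, pow_succ' _ n, ← mul_assoc (star x * x), h2]
      simp [mul_assoc]
    rw [h3, mul_assoc, ih, ← pow_succ']

/-! ### Passage to the unitization, where `a - t` makes sense. -/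

section NonUnitalCStarAlgebra

variable {A : Type*} [NonUnitalCStarAlgebra A]

theorem unitization_mul_inr_mul_eq_zero (hA : ∀ x : A, x * x = 0 → x = 0) {p q : Unitization ℂ A}
    (h : q * p = 0) (y : A) : p * (y : Unitization ℂ A) * q = 0 := by
  -- `A` is an ideal of its unitization, so the product lies in `A`, where reducedness is available.
  obtain ⟨z, hz⟩ : ∃ z : A, p * (y : Unitization ℂ A) * q = z :=
    ⟨(p * (y : Unitization ℂ A) * q).snd, by ext <;> simp⟩
  have : z = 0 := by
    apply hA
    apply Unitization.inr_injective (R := ℂ)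
    rw [Unitization.inr_mul, ← hz, Unitization.inr_zero]
    calc p * (y : Unitization ℂ A) * q * (p * y * q) = p * y * (q * p) * (y * q) := by
          noncomm_ring
      _ = 0 := by simp [h]
  rw [hz, this, Unitization.inr_zero]

theorem IsSelfAdjoint.commute_of_reduced (hA : ∀ x : A, x * x = 0 → x = 0) {a : A}
    (ha : IsSelfAdjoint a) (y : A) : a * y = y * a := by
  have : IsAddTorsionFree A := by
    have := Module.compHom A (algebraMap ℚ ℂ)
    exact .of_module_rat A
  refine commute_of_commutator_cube_eq_zero hA (fun y => ?_) y
  have ha' : IsSelfAdjoint (a : Unitization ℂ A) := ha.inr ℂ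
  have key := commutator_cube_eq_zero ha' (y := (y : Unitization ℂ A))
    (fun t => unitization_mul_inr_mul_eq_zero hA (cfc_negPart_mul_posPart _ t) y)
    (fun t => unitization_mul_inr_mul_eq_zero hA (cfc_posPart_mul_negPart _ t) y)
  apply Unitization.inr_injective (R := ℂ)
  rw [Unitization.inr_zero, ← key]
  simp only [Unitization.inr_add, Unitization.inr_sub, Unitization.inr_mul, Unitization.inr_smul]

/-- A C⋆-algebra without nonzero square-zero elements is commutative. -/
theorem mul_comm_of_reduced (hA : ∀ x : A, x * x = 0 → x = 0) (x y : A) : x * y = y * x := by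
  rw [← realPart_add_I_smul_imaginaryPart x]
  simp only [add_mul, mul_add, smul_mul_assoc, mul_smul_comm,
    (realPart x).2.commute_of_reduced hA y, (imaginaryPart x).2.commute_of_reduced hA y]

theorem Unitization.inr_posPow (x : A) (n : ℕ+) :
    ((posPow x n : A) : Unitization ℂ A) = (x : Unitization ℂ A) ^ (n : ℕ) := by
  rw [← posPow_eq_pow]
  induction n with
  | one => simp only [posPow_one]
  | succ k ih => rw [posPow_succ, posPow_succ, ← ih, Unitization.inr_mul]

end NonUnitalCStarAlgebra

theorem mainTheorem11 {A : Type*} [NonUnitalCStarAlgebra A]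
    (hA : ¬ ∀ x y : A, x * y = y * x) :
    ∃ a b : A, a * b = 0 ∧ ∀ n : ℕ+, posPow b n * posPow a n ≠ 0 := by
  obtain ⟨x, hxx, hx⟩ : ∃ x : A, x * x = 0 ∧ x ≠ 0 := by
    by_contra! h
    exact hA (mul_comm_of_reduced h)
  refine ⟨star x * x, x * star x + x, ?_, fun n h => ?_⟩
  · rw [mul_add, mul_assoc, ← mul_assoc x, mul_assoc (star x), hxx]
    simp
  · obtain ⟨m, hm⟩ : ∃ m : ℕ, (n : ℕ) = m + 1 := ⟨n - 1, (Nat.succ_pred n.ne_zero).symm⟩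
    set X : Unitization ℂ A := (x : Unitization ℂ A) with hX
    have hXX : X * X = 0 := by rw [hX, ← Unitization.inr_mul, hxx, Unitization.inr_zero]
    have hX0 : star X * X ≠ 0 := by
      rw [Ne, CStarRing.star_mul_self_eq_zero_iff]
      exact fun h0 => hx (Unitization.inr_injective (R := ℂ) (h0.trans (Unitization.inr_zero ℂ).symm))
    have h' : (X * star X + X) ^ (m + 1) * (star X * X) ^ (m + 1) = 0 := by
      have := congrArg (fun z : A => (z : Unitization ℂ A)) h
      simpa only [Unitization.inr_mul, Unitization.inr_posPow, Unitization.inr_add,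
        Unitization.inr_star, Unitization.inr_zero, hm, ← hX] using this
    -- One factor `star X * X` of `a ^ (m + 1)` is used by the compression, giving exponent `m + 2`;
    -- the other `m` remain.
    refine (IsSelfAdjoint.star_mul_self X).pow_ne_zero hX0 (m + 2 + m) ?_
    rw [pow_add, ← star_mul_pow_mul_star_mul_self hXX, mul_assoc, ← pow_succ', mul_assoc, h',
      mul_zero]
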